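/- Let $g\ge 0$ and $\ell\ge 1$ be integers, and let $\mathbb{R}\langle x,x^*\rangle$ be the free real algebra in the $2g$ noncommuting letters $x_1,\dots,x_g,x_1^*,\dots,x_g^*$, with the $\mathbb{R}$-linear involution determined by $(pq)^*=q^*p^*$, $x_i\mapsto x_i^*$ and $x_i^*\mapsto x_i$. Let $\mathbb{R}^{\nu\times\ell}\langle x,x^*\rangle$ be the $\nu\times\ell$ matrices over it, with the involution $(p^*)_{ij}=(p_{ji})^*$. For a tuple $X=(X_1,\dots,X_g)$ of real $n\times n$ matrices, $p(X)$ is obtained by substituting $x_i\mapsto X_i$, $x_i^*\mapsto X_i^{T}$ (entrywise, as a block matrix, if $p$ is a matrix of polynomials). A left module is a left $\mathbb{R}\langle x,x^*\rangle$-submodule $I\subseteq\mathbb{R}^{1\times\ell}\langle x,x^*\rangle$. A left module $I$ is real if, for all finite families $p_i\in\mathbb{R}^{1\times\ell}\langle x,x^*\rangle$, whenever $$\sum_i p_i^*p_i = M+N^*$$ for some $\ell\times\ell$ matrices $M,N$ over $\mathbb{R}\langle x,x^*\rangle$ all of whose rows belong to $I$, then every $p_i$ belongs to $I$. The real radical $\sqrt[\mathrm{re}]{I}$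 of $I$ is the intersection of all real left modules containing $I$. The vanishing radical of $I$ is $$\sqrt I=\{p\in\mathbb{R}^{1\times\ell}\langle x,x^*\rangle : p(X)v=0 \text{ for all } (X,v)\in V(I)\},$$ where $$V(I)=\bigcup_{n}\{(X,v)\in(\mathbb{R}^{n\times n})^g\times\mathbb{R}^{\ell n} : p(X)v=0\text{ for all }p\in I\}.$$ Let $L\in\mathbb{R}^{\ell\times\ell}\langle x,x^*\rangle$ be a monic linear pencil, that is, $L=L^*$, all entries of $L$ have degree at most $1$, and the matrix $L(0)$ of constant coefficients of $L$ is the identity matrix $\mathrm{Id}_\ell$. Let $I_L=\mathbb{R}^{1\times\ell}\langle x,x^*\rangle L$ be the left module generated by the rows of $L$. Then $$I_L=\sqrt[\mathrm{re}]{I_L}=\sqrt{I_L}.$$ -/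

import Mathlib

/-- Noncommutative polynomials `ℝ⟨x, x*⟩`: the free real algebra on the `2g` letters
`x₁, …, x_g` (`Sum.inl i`) and `x₁*, …, x_g*` (`Sum.inr i`). -/
abbrev NCPoly (g : ℕ) : Type := FreeAlgebra ℝ (Fin g ⊕ Fin g)

namespace NCPoly

/-- The involution of `ℝ⟨x, x*⟩`: the `ℝ`-linear anti-automorphism that exchanges `x_i` and `x_i*`.
(This is not Mathlib's `star` on a free algebra, which fixes all the letters.) -/
noncomputable def adj {g : ℕ} (p : NCPoly g) : NCPoly g :=
  MulOpposite.unop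
    (FreeAlgebra.lift ℝ
      (fun s : Fin g ⊕ Fin g => MulOpposite.op (FreeAlgebra.ι ℝ s.swap : NCPoly g)) p)

/-- The involution on matrices of noncommutative polynomials. -/
noncomputable def matAdj {g : ℕ} {m n : Type*} (P : Matrix m n (NCPoly g)) :
    Matrix n m (NCPoly g) :=
  (P.map adj).transpose

/-- Evaluation `p(X)` at a tuple of real `n × n` matrices: `x_i ↦ X_i`, `x_i* ↦ X_iᵀ`. -/
noncomputable def eval {g n : ℕ} (X : Fin g → Matrix (Fin n) (Fin n) ℝ) :
    NCPoly g →ₐ[ℝ] Matrix (Fin n) (Fin n) ℝ :=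
  FreeAlgebra.lift ℝ (Sum.elim X (fun i => (X i).transpose))

/-- Evaluation of a row `p ∈ ℝ^{1×ℓ}⟨x, x*⟩` at `X`: the `n × ℓn` real block row
`(p₁(X), …, p_ℓ(X))`, with columns indexed by pairs (block, index in the block). -/
noncomputable def evalRow {g n ℓ : ℕ} (X : Fin g → Matrix (Fin n) (Fin n) ℝ)
    (p : Fin ℓ → NCPoly g) : Matrix (Fin n) (Fin ℓ × Fin n) ℝ :=
  Matrix.of fun a jb => eval X (p jb.1) a jb.2

/-- The noncommutative polynomials of degree at most `d`: the span of the words of length at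
most `d`. -/
noncomputable def degLE (g d : ℕ) : Submodule ℝ (NCPoly g) :=
  Submodule.span ℝ
    {w | ∃ l : List (Fin g ⊕ Fin g), l.length ≤ d ∧ w = (l.map (FreeAlgebra.ι ℝ)).prod}

/-- Linear pencils: symmetric square matrices of noncommutative polynomials of degree at most 1. -/
def IsLinearPencil {g ℓ : ℕ} (L : Matrix (Fin ℓ) (Fin ℓ) (NCPoly g)) : Prop :=
  matAdj L = L ∧ ∀ i j, L i j ∈ degLE g 1

/-- Monic linear pencils: the matrix `L(0)` of constant coefficients is the identity. -/
def IsMonicLinearPencil {g ℓ : ℕ} (L : Matrix (Fin ℓ) (Fin ℓ) (NCPoly g)) : Prop :=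
  IsLinearPencil L ∧ L.map FreeAlgebra.algebraMapInv = (1 : Matrix (Fin ℓ) (Fin ℓ) ℝ)

/-- The left module `I_L ⊆ ℝ^{1×ℓ}⟨x, x*⟩` generated by the rows of `L`. -/
def rowModule {g ℓ : ℕ} (L : Matrix (Fin ℓ) (Fin ℓ) (NCPoly g)) :
    Submodule (NCPoly g) (Fin ℓ → NCPoly g) :=
  Submodule.span (NCPoly g) (Set.range L.row)

/-- `ℝ^{ν×1} I`: the `ν × ℓ` matrices all of whose rows lie in `I`. -/
def RowsIn {g ℓ : ℕ} {ν : Type*} (I : Submodule (NCPoly g) (Fin ℓ → NCPoly g))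
    (M : Matrix ν (Fin ℓ) (NCPoly g)) : Prop :=
  ∀ i, M.row i ∈ I

/-- `I` is `L`-real: whenever
`∑ p_i* p_i + ∑ q_j* L q_j ∈ ℝ^{ℓ×1} I + I* ℝ^{1×ℓ}` (finite sums, with `p_i` of size `1 × ℓ` and
`q_j` of size `ν × ℓ`), all the `p_i` lie in `I` and all the `L q_j` lie in `ℝ^{ν×1} I`. -/
def IsLReal {g ℓ ν : ℕ} (L : Matrix (Fin ν) (Fin ν) (NCPoly g))
    (I : Submodule (NCPoly g) (Fin ℓ → NCPoly g)) : Prop :=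
  ∀ (a b : ℕ) (p : Fin a → Fin ℓ → NCPoly g) (q : Fin b → Matrix (Fin ν) (Fin ℓ) (NCPoly g)),
    (∃ M N : Matrix (Fin ℓ) (Fin ℓ) (NCPoly g), RowsIn I M ∧ RowsIn I N ∧
      (∑ i, Matrix.vecMulVec (fun k => adj (p i k)) (p i)) + (∑ j, matAdj (q j) * L * q j)
        = M + matAdj N) →
    (∀ i, p i ∈ I) ∧ (∀ j, RowsIn I (L * q j))

/-- The `L`-real radical: the intersection of all `L`-real left modules that contain `I`. -/
def lRealRadical {g ℓ ν : ℕ} (L : Matrix (Fin ν) (Fin ν) (NCPoly g))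
    (I : Submodule (NCPoly g) (Fin ℓ → NCPoly g)) : Submodule (NCPoly g) (Fin ℓ → NCPoly g) :=
  sInf {J | I ≤ J ∧ IsLReal L J}

/-- The real radical: the `L`-real radical for the `1 × 1` pencil `L = 1`. -/
def realRadical {g ℓ : ℕ} (I : Submodule (NCPoly g) (Fin ℓ → NCPoly g)) :
    Submodule (NCPoly g) (Fin ℓ → NCPoly g) :=
  lRealRadical (1 : Matrix (Fin 1) (Fin 1) (NCPoly g)) I

/-- The points `(X, v)`, with `X` a `g`-tuple of real `n × n` matrices and `v ∈ ℝ^{ℓn}`, over all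
sizes `n`. -/
abbrev Point (g ℓ : ℕ) : Type :=
  Σ n : ℕ, (Fin g → Matrix (Fin n) (Fin n) ℝ) × (Fin ℓ × Fin n → ℝ)

/-- `V(S)`: the points `(X, v)` with `p(X) v = 0` for all `p ∈ S`. -/
def zeroSet {g ℓ : ℕ} (S : Set (Fin ℓ → NCPoly g)) : Set (Point g ℓ) :=
  {z | ∀ p ∈ S, (evalRow z.2.1 p).mulVec z.2.2 = 0}

theorem evalRow_add {g n ℓ : ℕ} (X : Fin g → Matrix (Fin n) (Fin n) ℝ)
    (p q : Fin ℓ → NCPoly g) : evalRow X (p + q) = evalRow X p + evalRow X q := by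
  ext a jb
  simp [evalRow]

theorem evalRow_zero {g n ℓ : ℕ} (X : Fin g → Matrix (Fin n) (Fin n) ℝ) :
    evalRow X (0 : Fin ℓ → NCPoly g) = 0 := by
  ext a jb
  simp [evalRow]

theorem evalRow_smul {g n ℓ : ℕ} (X : Fin g → Matrix (Fin n) (Fin n) ℝ) (r : NCPoly g)
    (p : Fin ℓ → NCPoly g) : evalRow X (r • p) = eval X r * evalRow X p := by
  ext a jb
  simp [evalRow, Matrix.mul_apply]

/-- `𝓘(W)`: the left module of all `p ∈ ℝ^{1×ℓ}⟨x, x*⟩` with `p(X) v = 0` for all `(X, v) ∈ W`. -/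
def vanishingModule {g ℓ : ℕ} (W : Set (Point g ℓ)) :
    Submodule (NCPoly g) (Fin ℓ → NCPoly g) where
  carrier := {p | ∀ z ∈ W, (evalRow z.2.1 p).mulVec z.2.2 = 0}
  add_mem' := fun {p q} hp hq z hz => by
    rw [evalRow_add, Matrix.add_mulVec, hp z hz, hq z hz, add_zero]
  zero_mem' := fun z _ => by
    rw [evalRow_zero, Matrix.zero_mulVec]
  smul_mem' := fun r p hp z hz => by
    rw [evalRow_smul, ← Matrix.mulVec_mulVec, hp z hz, Matrix.mulVec_zero]

/-- The vanishing radical `√I = 𝓘(V(I))`. -/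
def vanishingRadical {g ℓ : ℕ} (I : Submodule (NCPoly g) (Fin ℓ → NCPoly g)) :
    Submodule (NCPoly g) (Fin ℓ → NCPoly g) :=
  vanishingModule (zeroSet (I : Set (Fin ℓ → NCPoly g)))

end NCPoly

/-! ### Positivity: the chain from a left module to its vanishing radical -/

namespace NCPoly

open Matrix

/-! The inclusions of `I_L` in its real radical and of that in `√I_L` are formal: at a zero `(X, v)`
a sum of squares lying in `M + N*` evaluates to `∑ |p_i(X)v|² = 0`. What remains is `√I_L ≤ I_L`.
For a given row `p`, one point of `V(I_L)` is built at which `p` can vanish only if `p ∈ I_L`.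

Write `L = Id + ∑ B_s x_s` over all `2g` letters, with `B_sᵀ = B_{s*}`. Constant rows in `Z = ⋂ ker
B_s` lie in `I_L`. For `c` in `K = Zᗮ`, the relation `cᵀL ≡ 0` reads `c ≡ ∑ x_s (V c)_s` with `(V
c)_s = -B_{s*} c`, and `V : K → H = K^{2g}` is injective. With a left inverse `W` of `V` and `T = 1
- V W`, every row is congruent to a sum of words times homogeneous linear rows, whose coefficients
at nonempty words are fixed by `T` (`exists_wordSum_sub_mem`).

The point lives on a truncated Fock space over `H`, whose vacuum level models the linear rows. The
relations force `x_s` to send `V c` to `c` in slot `s`. An extension `a_s` with `a_s* = a_{s*}`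
exists because this prescription is symmetric (`extendAlong_adjoint`, `ins_adjoint_comp_pencilVec`).
Adding creation and annihilation terms keeps that adjoint relation and makes the normal forms
independent (`eq_zero_of_sum_fockOp_eq_zero`). So if `p` vanishes at the point, its normal form is
zero. -/

theorem adj_add {g : ℕ} (p q : NCPoly g) : adj (p + q) = adj p + adj q := by
  simp [adj]

theorem adj_mul {g : ℕ} (p q : NCPoly g) : adj (p * q) = adj q * adj p := by
  simp [adj]

theorem adj_algebraMap {g : ℕ} (r : ℝ) :
    adj (algebraMap ℝ (NCPoly g) r) = algebraMap ℝ (NCPoly g) r := by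
  simp only [adj, AlgHom.commutes, MulOpposite.algebraMap_apply, MulOpposite.unop_op]

theorem adj_ι {g : ℕ} (s : Fin g ⊕ Fin g) :
    adj (FreeAlgebra.ι ℝ s : NCPoly g) = FreeAlgebra.ι ℝ s.swap := by
  simp only [adj, FreeAlgebra.lift_ι_apply, MulOpposite.unop_op]

theorem eval_adj {g n : ℕ} (X : Fin g → Matrix (Fin n) (Fin n) ℝ) (p : NCPoly g) :
    eval X (adj p) = (eval X p)ᵀ := by
  induction p using FreeAlgebra.induction with
  | grade0 r =>
    rw [adj_algebraMap, AlgHom.commutes, Matrix.algebraMap_eq_diagonal, Matrix.diagonal_transpose]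
  | grade1 s => cases s <;> simp [adj_ι, eval]
  | mul p q hp hq => rw [adj_mul, map_mul, map_mul, hp, hq, Matrix.transpose_mul]
  | add p q hp hq => rw [adj_add, map_add, map_add, hp, hq, Matrix.transpose_add]

/-- The blocks `v_1, …, v_ℓ` of a vector `v ∈ ℝ^{ℓn}`. -/
def block {n ℓ : ℕ} (v : Fin ℓ × Fin n → ℝ) (i : Fin ℓ) : Fin n → ℝ := fun a => v (i, a)

theorem evalRow_mulVec {g n ℓ : ℕ} (X : Fin g → Matrix (Fin n) (Fin n) ℝ)
    (p : Fin ℓ → NCPoly g) (v : Fin ℓ × Fin n → ℝ) :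
    (evalRow X p).mulVec v = ∑ i, (eval X (p i)) *ᵥ block v i := by
  ext a
  simp [Matrix.mulVec, dotProduct, evalRow, block, Fintype.sum_prod_type]

/-- The value `vᵀ A(X) v` of the quadratic form of an `ℓ × ℓ` matrix of polynomials. -/
noncomputable def quadForm {g n ℓ : ℕ} (X : Fin g → Matrix (Fin n) (Fin n) ℝ)
    (v : Fin ℓ × Fin n → ℝ) (A : Matrix (Fin ℓ) (Fin ℓ) (NCPoly g)) : ℝ :=
  ∑ i, ∑ j, block v i ⬝ᵥ (eval X (A i j) *ᵥ block v j)

section quadForm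

variable {g n ℓ : ℕ} (X : Fin g → Matrix (Fin n) (Fin n) ℝ) (v : Fin ℓ × Fin n → ℝ)

theorem quadForm_add (A B : Matrix (Fin ℓ) (Fin ℓ) (NCPoly g)) :
    quadForm X v (A + B) = quadForm X v A + quadForm X v B := by
  simp [quadForm, Matrix.add_mulVec, Finset.sum_add_distrib]

theorem quadForm_sum {ι : Type*} (s : Finset ι) (A : ι → Matrix (Fin ℓ) (Fin ℓ) (NCPoly g)) :
    quadForm X v (∑ i ∈ s, A i) = ∑ i ∈ s, quadForm X v (A i) := by
  classical
  induction s using Finset.induction_on with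
  | empty => simp [quadForm]
  | insert i s hi ih => rw [Finset.sum_insert hi, Finset.sum_insert hi, quadForm_add, ih]

/-- A real number equals its transpose; this is why `N*` contributes nothing when `N` does not. -/
theorem quadForm_matAdj (A : Matrix (Fin ℓ) (Fin ℓ) (NCPoly g)) :
    quadForm X v (matAdj A) = quadForm X v A := by
  unfold quadForm
  rw [Finset.sum_comm]
  refine Finset.sum_congr rfl fun i _ => Finset.sum_congr rfl fun j _ => ?_
  rw [matAdj, Matrix.transpose_apply, Matrix.map_apply, eval_adj, Matrix.mulVec_transpose,
    dotProduct_comm, Matrix.dotProduct_mulVec]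

theorem quadForm_of_rows (A : Matrix (Fin ℓ) (Fin ℓ) (NCPoly g))
    (hA : ∀ i, (evalRow X (A.row i)).mulVec v = 0) : quadForm X v A = 0 := by
  refine Finset.sum_eq_zero fun i _ => ?_
  rw [← dotProduct_sum]
  have := hA i
  rw [evalRow_mulVec] at this
  simp only [Matrix.row] at this
  rw [this, dotProduct_zero]

theorem quadForm_square (p : Fin ℓ → NCPoly g) :
    quadForm X v (Matrix.vecMulVec (fun k => adj (p k)) p)
      = (evalRow X p).mulVec v ⬝ᵥ (evalRow X p).mulVec v := by
  rw [evalRow_mulVec, sum_dotProduct]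
  refine Finset.sum_congr rfl fun i _ => ?_
  rw [dotProduct_sum]
  refine Finset.sum_congr rfl fun j _ => ?_
  rw [Matrix.vecMulVec_apply, map_mul, eval_adj, ← Matrix.mulVec_mulVec, Matrix.dotProduct_mulVec,
    Matrix.vecMul_transpose]

end quadForm

theorem matAdj_mul_one_mul {g ℓ : ℕ} (q : Matrix (Fin 1) (Fin ℓ) (NCPoly g)) :
    matAdj q * (1 : Matrix (Fin 1) (Fin 1) (NCPoly g)) * q = Matrix.vecMulVec (fun k => adj (q 0 k)) (q 0) := by
  ext i j
  simp [Matrix.mul_apply, matAdj, Matrix.vecMulVec_apply]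

theorem isLReal_vanishingModule {g ℓ : ℕ} (W : Set (Point g ℓ)) :
    IsLReal (1 : Matrix (Fin 1) (Fin 1) (NCPoly g)) (vanishingModule W) := by
  rintro a b p q ⟨M, N, hM, hN, h⟩
  have key : ∀ z ∈ W,
      (∀ i, (evalRow z.2.1 (p i)).mulVec z.2.2 = 0) ∧
      ∀ j, (evalRow z.2.1 (q j 0)).mulVec z.2.2 = 0 := by
    intro z hz
    -- The quadratic form kills `M` and `N*`, and turns every remaining term into a squared norm.
    have h' := congrArg (quadForm z.2.1 z.2.2) h
    simp only [matAdj_mul_one_mul] at h'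
    rw [quadForm_add, quadForm_add, quadForm_sum, quadForm_sum, quadForm_matAdj,
      quadForm_of_rows _ _ M (fun i => hM i z hz), quadForm_of_rows _ _ N (fun i => hN i z hz)] at h'
    simp only [quadForm_square, add_zero] at h'
    have nn : ∀ w : Fin z.1 → ℝ, 0 ≤ w ⬝ᵥ w := fun w =>
      Finset.sum_nonneg fun i _ => mul_self_nonneg _
    have h1 := (add_eq_zero_iff_of_nonneg (Finset.sum_nonneg fun i _ => nn _)
      (Finset.sum_nonneg fun i _ => nn _)).1 h'
    rw [Finset.sum_eq_zero_iff_of_nonneg (fun i _ => nn _),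
      Finset.sum_eq_zero_iff_of_nonneg (fun i _ => nn _)] at h1
    exact ⟨fun i => dotProduct_self_eq_zero.1 (h1.1 i (Finset.mem_univ _)),
      fun j => dotProduct_self_eq_zero.1 (h1.2 j (Finset.mem_univ _))⟩
  refine ⟨fun i z hz => (key z hz).1 i, fun j i z hz => ?_⟩
  rw [Matrix.one_mul, Subsingleton.elim i 0]
  exact (key z hz).2 j

theorem le_vanishingRadical {g ℓ : ℕ} (I : Submodule (NCPoly g) (Fin ℓ → NCPoly g)) :
    I ≤ vanishingRadical I := fun p hp _ hz => hz p hp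

theorem le_realRadical {g ℓ : ℕ} (I : Submodule (NCPoly g) (Fin ℓ → NCPoly g)) :
    I ≤ realRadical I := le_sInf fun _ hJ => hJ.1

theorem realRadical_le_vanishingRadical {g ℓ : ℕ}
    (I : Submodule (NCPoly g) (Fin ℓ → NCPoly g)) : realRadical I ≤ vanishingRadical I :=
  sInf_le ⟨le_vanishingRadical I, isLReal_vanishingModule _⟩

end NCPoly

namespace NCPoly

open scoped InnerProductSpace

/-! ### Extending a partially defined operator with prescribed adjoint -/

section Extension

variable {K H α : Type*} [NormedAddCommGroup K] [InnerProductSpace ℝ K] [FiniteDimensional ℝ K]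
  [NormedAddCommGroup H] [InnerProductSpace ℝ H] [FiniteDimensional ℝ H]

/-- The operator on `H` that extends `c ↦ f c` along an embedding `V` with left inverse `W`; its
adjoint is the extension of `f'` when `f' * V` is the adjoint of `V * f`. -/
noncomputable def extendAlong (V : K →ₗ[ℝ] H) (W : H →ₗ[ℝ] K) (f f' : K →ₗ[ℝ] H) : H →ₗ[ℝ] H :=
  f ∘ₗ W + (f' ∘ₗ W).adjoint - W.adjoint ∘ₗ V.adjoint ∘ₗ f ∘ₗ W

/-- On the range of `V` the second and third terms cancel, which is exactly the compatibility `hf`.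
-/
theorem extendAlong_apply {V : K →ₗ[ℝ] H} {W : H →ₗ[ℝ] K} {f f' : K →ₗ[ℝ] H}
    (hW : ∀ c, W (V c) = c) (hf : f'.adjoint ∘ₗ V = V.adjoint ∘ₗ f) (c : K) :
    extendAlong V W f f' (V c) = f c := by
  have h := LinearMap.congr_fun hf c
  simp only [LinearMap.comp_apply] at h
  simp [extendAlong, LinearMap.adjoint_comp, hW, h]

/-- Taking adjoints swaps the first two terms, and `hf` carries the correction term to the one with
`f` and `f'` exchanged. -/
theorem extendAlong_adjoint {V : K →ₗ[ℝ] H} {W : H →ₗ[ℝ] K} {f f' : K →ₗ[ℝ] H}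
    (hf : f'.adjoint ∘ₗ V = V.adjoint ∘ₗ f) :
    (extendAlong V W f f').adjoint = extendAlong V W f' f := by
  have h := congrArg LinearMap.adjoint hf
  simp only [LinearMap.adjoint_comp, LinearMap.adjoint_adjoint] at h
  simp only [extendAlong, map_add, map_sub, LinearMap.adjoint_comp, LinearMap.adjoint_adjoint]
  rw [← LinearMap.comp_assoc W f' V.adjoint, h]
  simp only [LinearMap.comp_assoc]
  abel

end Extension

/-! ### Truncated Fock space and independence of words -/

section Fock

set_option linter.unusedSectionVars false

variable {α H : Type*} [Fintype α] [DecidableEq α]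
  [NormedAddCommGroup H] [InnerProductSpace ℝ H] [FiniteDimensional ℝ H] (N : ℕ)

/-- Words of length less than `N`. -/
abbrev ShortWord (α : Type*) (N : ℕ) : Type _ := {l : List α // l.length < N}

noncomputable instance : Fintype (ShortWord α N) :=
  (List.finite_length_lt α N).fintype

/-- The truncated Fock space: sums of copies of `H` over the words of length less than `N`. -/
abbrev Fock (α H : Type*) (N : ℕ) : Type _ := PiLp 2 (fun _ : ShortWord α N => H)

variable {N}

/-- The coefficient of the word `s :: w` is `y w` (or `T (y w)` if `w` is empty). -/
noncomputable def creation (T : H →ₗ[ℝ] H) (s : α) : Fock α H N →ₗ[ℝ] Fock α H N where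
  toFun y := WithLp.toLp 2 fun w => match w with
    | ⟨[], _⟩ => 0
    -- Applying `T` only on leaving the vacuum lets creation kill the vacuum vectors in `ker T`,
    -- where the action of the letters is already prescribed.
    | ⟨[t], h⟩ => if t = s then T (y ⟨[], Nat.lt_of_succ_lt h⟩) else 0
    | ⟨t :: r :: w, h⟩ => if t = s then y ⟨r :: w, Nat.lt_of_succ_lt h⟩ else 0
  map_add' y z := by
    ext ⟨w, h⟩
    rcases w with _ | ⟨t, _ | ⟨r, w⟩⟩
    · simp
    · by_cases ht : t = s <;> simp [ht]
    · by_cases ht : t = s <;> simp [ht]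
  map_smul' c y := by
    ext ⟨w, h⟩
    rcases w with _ | ⟨t, _ | ⟨r, w⟩⟩
    · simp
    · by_cases ht : t = s <;> simp [ht]
    · by_cases ht : t = s <;> simp [ht]

/-- An operator on `H` acting on the summand of the empty word. -/
noncomputable def vacuumOp (A : H →ₗ[ℝ] H) : Fock α H N →ₗ[ℝ] Fock α H N where
  toFun y := WithLp.toLp 2 fun w => if w.1 = [] then A (y w) else 0
  map_add' y z := by
    ext w
    by_cases hw : w.1 = [] <;> simp [hw]
  map_smul' c y := by
    ext w
    by_cases hw : w.1 = [] <;> simp [hw]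

/-- The embedding of `H` as the summand of the empty word. -/
noncomputable def vacuum (N : ℕ) : H →ₗ[ℝ] Fock α H (N + 1) where
  toFun h := WithLp.toLp 2 fun w => if w.1 = [] then h else 0
  map_add' y z := by
    ext w
    by_cases hw : w.1 = [] <;> simp [hw]
  map_smul' c y := by
    ext w
    by_cases hw : w.1 = [] <;> simp [hw]

theorem creation_singleton (T : H →ₗ[ℝ] H) (s t : α) (y : Fock α H N) (h) :
    creation T s y ⟨[t], h⟩ = if t = s then T (y ⟨[], Nat.lt_of_succ_lt h⟩) else 0 := rfl

theorem creation_cons_cons (T : H →ₗ[ℝ] H) (s t r : α) (w : List α) (y : Fock α H N) (h) :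
    creation T s y ⟨t :: r :: w, h⟩
      = if t = s then y ⟨r :: w, Nat.lt_of_succ_lt h⟩ else 0 := rfl

theorem vacuumOp_apply (A : H →ₗ[ℝ] H) (y : Fock α H N) (w : ShortWord α N) :
    vacuumOp A y w = if w.1 = [] then A (y w) else 0 := rfl

theorem vacuum_apply (h : H) (w : ShortWord α (N + 1)) :
    vacuum N h w = if w.1 = [] then h else 0 := rfl

theorem vacuumOp_adjoint (A : H →ₗ[ℝ] H) :
    (vacuumOp A : Fock α H N →ₗ[ℝ] Fock α H N).adjoint = vacuumOp A.adjoint := by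
  symm
  rw [LinearMap.eq_adjoint_iff]
  intro x y
  simp only [PiLp.inner_apply, vacuumOp_apply]
  refine Finset.sum_congr rfl fun w _ => ?_
  by_cases hw : w.1 = [] <;> simp [hw, LinearMap.adjoint_inner_left]

theorem vacuumOp_vacuum (A : H →ₗ[ℝ] H) (h : H) :
    vacuumOp A (vacuum N h : Fock α H (N + 1)) = vacuum N (A h) := by
  ext w
  by_cases hw : w.1 = [] <;> simp [vacuumOp_apply, vacuum_apply, hw]

theorem creation_vacuum {T : H →ₗ[ℝ] H} {h : H} (hT : T h = 0) (s : α) :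
    creation T s (vacuum N h : Fock α H (N + 1)) = 0 := by
  ext ⟨w, hw⟩
  rcases w with _ | ⟨t, _ | ⟨r, w⟩⟩
  · rfl
  · simp [creation_singleton, vacuum_apply, hT]
  · simp [creation_cons_cons, vacuum_apply]

/-- Annihilation does not raise the level. -/
theorem creation_adjoint_apply (T : H →ₗ[ℝ] H) (s : α) {y : Fock α H N} {m : ℕ}
    (hy : ∀ w : ShortWord α N, m < w.1.length → y w = 0) (w : ShortWord α N)
    (hw : m ≤ w.1.length) : (creation T s).adjoint y w = 0 := by
  classical
  refine ext_inner_right ℝ fun h => ?_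
  have h1 : ⟪(creation T s).adjoint y w, h⟫_ℝ
      = ⟪(creation T s).adjoint y, PiLp.single 2 w h⟫_ℝ := by
    rw [PiLp.inner_apply, Finset.sum_eq_single w]
    · simp
    · intro b _ hb
      simp [hb]
    · simp
  rw [h1, LinearMap.adjoint_inner_left, PiLp.inner_apply, inner_zero_left]
  refine Finset.sum_eq_zero fun u _ => ?_
  by_cases hu : m < u.1.length
  · rw [hy u hu, inner_zero_left]
  · obtain ⟨u, hu'⟩ := u
    obtain ⟨w, hw'⟩ := w
    have : creation T s (PiLp.single 2 ⟨w, hw'⟩ h) ⟨u, hu'⟩ = 0 := by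
      rcases u with _ | ⟨t, _ | ⟨r, u⟩⟩
      · rfl
      · rw [creation_singleton, PiLp.single_eq_of_ne]
        · simp
        · rintro h
          simp only [Subtype.mk.injEq] at h
          subst h
          simp at hu hw
          omega
      · rw [creation_cons_cons, PiLp.single_eq_of_ne]
        · simp
        · rintro h
          simp only [Subtype.mk.injEq] at h
          subst h
          simp at hu hw
          omega
    rw [this, inner_zero_right]

/-- The operators `a_s + c_s + c_{σ s}*` on the truncated Fock space. -/
noncomputable def fockOp (σ : α → α) (T : H →ₗ[ℝ] H) (a : α → H →ₗ[ℝ] H) (s : α) :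
    Fock α H N →ₗ[ℝ] Fock α H N :=
  vacuumOp (a s) + creation T s + (creation T (σ s)).adjoint

section fockOp

variable {σ : α → α} {T : H →ₗ[ℝ] H} {a : α → H →ₗ[ℝ] H}

theorem fockOp_adjoint (hσ : Function.Involutive σ) (ha : ∀ s, (a s).adjoint = a (σ s)) (s : α) :
    (fockOp σ T a s : Fock α H N →ₗ[ℝ] Fock α H N).adjoint = fockOp σ T a (σ s) := by
  simp only [fockOp, map_add, vacuumOp_adjoint, ha, LinearMap.adjoint_adjoint, hσ s]
  abel

/-- Annihilation kills the vacuum level and creation sees only `T h`, so on `ker T` only `a s`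
survives. -/
theorem fockOp_vacuum {h : H} (hT : T h = 0) (s : α) :
    fockOp σ T a s (vacuum N h : Fock α H (N + 1)) = vacuum N (a s h) := by
  have h1 : (creation T (σ s)).adjoint (vacuum N h : Fock α H (N + 1)) = 0 := by
    ext w
    refine creation_adjoint_apply (m := 0) T _ (fun u hu => ?_) w (Nat.zero_le _)
    rw [vacuum_apply, if_neg (List.ne_nil_of_length_pos hu)]
  simp [fockOp, vacuumOp_vacuum, creation_vacuum hT, h1]

/-- Above the highest occupied level only creation can contribute. -/
theorem fockOp_apply_cons (s t : α) (w : List α) {y : Fock α H N}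
    (hy : ∀ u : ShortWord α N, w.length < u.1.length → y u = 0) (h) :
    fockOp σ T a s y ⟨t :: w, h⟩ = creation T s y ⟨t :: w, h⟩ := by
  have h1 := creation_adjoint_apply T (σ s) hy ⟨t :: w, h⟩ (by simp)
  simp [fockOp, vacuumOp_apply, h1]

theorem fockOp_word_of_length_lt (l : List α) (h : H) (w : ShortWord α (N + 1))
    (hw : l.length < w.1.length) :
    (l.map (fockOp σ T a)).prod (vacuum N h : Fock α H (N + 1)) w = 0 := by
  induction l generalizing w with
  | nil => 
    rw [List.map_nil, List.prod_nil, Module.End.one_apply, vacuum_apply,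
      if_neg (List.ne_nil_of_length_pos hw)]
  | cons s l ih =>
    obtain ⟨w, hw'⟩ := w
    rw [List.map_cons, List.prod_cons, Module.End.mul_apply]
    rcases w with _ | ⟨t, _ | ⟨r, w⟩⟩
    · simp at hw
    · simp at hw
    · have hl : l.length < w.length + 1 := by simpa using hw
      rw [fockOp_apply_cons, creation_cons_cons, ih ⟨r :: w, _⟩ (by simpa using hl), ite_self]
      intro u hu
      exact ih u (hl.trans (by simpa using hu))

/-- The leading component of a word `l` applied to `h` sits at `l` itself; it is `h` for the empty
word and `T h` otherwise. The outer `T` makes the two cases uniform. -/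
theorem fockOp_word_of_length_eq (hTT : ∀ h, T (T h) = T h) (l : List α) (h : H)
    (w : ShortWord α (N + 1)) (hw : l.length = w.1.length) :
    T ((l.map (fockOp σ T a)).prod (vacuum N h : Fock α H (N + 1)) w)
      = if w.1 = l then T h else 0 := by
  induction l generalizing w with
  | nil =>
    have : w.1 = [] := List.length_eq_zero_iff.1 hw.symm
    rw [List.map_nil, List.prod_nil, Module.End.one_apply, vacuum_apply, if_pos this, if_pos this]
  | cons s l ih =>
    obtain ⟨w, hw'⟩ := w
    rw [List.map_cons, List.prod_cons, Module.End.mul_apply]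
    rcases w with _ | ⟨t, w⟩
    · simp at hw
    have hl : l.length = w.length := by simpa using hw
    rw [fockOp_apply_cons s t w fun u hu => fockOp_word_of_length_lt l h u (hl ▸ hu)]
    have key : T (creation T s ((l.map (fockOp σ T a)).prod (vacuum N h)) ⟨t :: w, hw'⟩)
        = if t = s then T ((l.map (fockOp σ T a)).prod (vacuum N h)
          ⟨w, Nat.lt_of_succ_lt hw'⟩) else 0 := by
      rcases w with _ | ⟨r, w⟩
      · rw [creation_singleton]
        split_ifs
        · rw [hTT]
        · simp
      · rw [creation_cons_cons]
        split_ifs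
        · rfl
        · simp
    rw [key, ih ⟨w, _⟩ hl]
    by_cases hts : t = s <;> simp [hts]

/-- Sums of words applied to vectors at level zero are independent. -/
theorem eq_zero_of_sum_fockOp_eq_zero (hTT : ∀ h, T (T h) = T h) (u : List α →₀ H)
    (hu : ∀ l, l ≠ [] → T (u l) = u l) (hN : ∀ l ∈ u.support, l.length ≤ N)
    (h0 : (u.sum fun l h => (l.map (fockOp σ T a)).prod (vacuum N h : Fock α H (N + 1))) = 0) :
    u = 0 := by
  by_contra hne
  -- At a longest word of the support there is no interference from the other words.
  obtain ⟨l, hl, hmax⟩ := Finset.exists_max_image u.support List.length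
    (Finsupp.support_nonempty_iff.2 hne)
  have hw : l.length < N + 1 := Nat.lt_succ_of_le (hN l hl)
  have hul : u l ≠ 0 := Finsupp.mem_support_iff.1 hl
  have h1 := congrArg (fun y : Fock α H (N + 1) => y ⟨l, hw⟩) h0
  simp only [Finsupp.sum, WithLp.ofLp_sum, Finset.sum_apply, PiLp.zero_apply] at h1
  -- The value at the empty word need not be fixed by `T`, but if that word is longest it is the
  -- only one, and its component is read off directly.
  rcases eq_or_ne l [] with rfl | hnil
  · have hs : ∀ m ∈ u.support, m = [] := fun m hm => by
      simpa using hmax m hm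
    rw [Finset.sum_eq_single []] at h1
    · apply hul
      simpa [vacuum_apply] using h1
    · intro m hm hm'
      exact absurd (hs m hm) hm'
    · intro h
      exact absurd hl h
  · have h2 := congrArg T h1
    rw [map_sum, map_zero, Finset.sum_eq_single l] at h2
    · rw [fockOp_word_of_length_eq hTT l (u l) ⟨l, hw⟩ rfl, if_pos rfl, hu l hnil] at h2
      exact hul h2
    · intro m hm hml
      rcases (hmax m hm).lt_or_eq with hlt | heq
      · rw [fockOp_word_of_length_lt m _ _ hlt, map_zero]
      · rw [fockOp_word_of_length_eq hTT m (u m) ⟨l, hw⟩ heq, if_neg (Ne.symm hml)]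
    · intro h
      exact absurd hl h

end fockOp

end Fock

end NCPoly

namespace NCPoly

open scoped InnerProductSpace
open Matrix

/-! ### From operators on a Euclidean space to real matrices -/

section Transfer

variable {g ℓ : ℕ} {H : Type*} [NormedAddCommGroup H] [InnerProductSpace ℝ H]

/-- The value at a tuple of operators `X` and vectors `v` of a row of polynomials. -/
noncomputable def evalAt (X : Fin g ⊕ Fin g → H →ₗ[ℝ] H) (v : Fin ℓ → H) :
    (Fin ℓ → NCPoly g) →ₗ[ℝ] H where
  toFun p := ∑ k, FreeAlgebra.lift ℝ X (p k) (v k)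
  map_add' p q := by simp [Finset.sum_add_distrib]
  map_smul' c p := by simp [Finset.smul_sum]

theorem evalAt_apply (X : Fin g ⊕ Fin g → H →ₗ[ℝ] H) (v : Fin ℓ → H) (p : Fin ℓ → NCPoly g) :
    evalAt X v p = ∑ k, FreeAlgebra.lift ℝ X (p k) (v k) := rfl

theorem evalAt_smul (X : Fin g ⊕ Fin g → H →ₗ[ℝ] H) (v : Fin ℓ → H) (r : NCPoly g)
    (p : Fin ℓ → NCPoly g) : evalAt X v (r • p) = FreeAlgebra.lift ℝ X r (evalAt X v p) := by
  simp [evalAt_apply]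

theorem evalAt_eq_zero_of_mem_span {X : Fin g ⊕ Fin g → H →ₗ[ℝ] H} {v : Fin ℓ → H}
    {S : Set (Fin ℓ → NCPoly g)} (hS : ∀ q ∈ S, evalAt X v q = 0) {p : Fin ℓ → NCPoly g}
    (hp : p ∈ Submodule.span (NCPoly g) S) : evalAt X v p = 0 := by
  induction hp using Submodule.span_induction with
  | mem q hq => exact hS q hq
  | zero => exact map_zero _
  | add p q _ _ hp hq => rw [map_add, hp, hq, add_zero]
  | smul r p _ hp => rw [evalAt_smul, hp, map_zero]

theorem evalAt_eq_zero_of_mem_vanishingRadical [FiniteDimensional ℝ H]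
    {X : Fin g ⊕ Fin g → H →ₗ[ℝ] H} {v : Fin ℓ → H} (hX : ∀ s, (X s).adjoint = X s.swap)
    {I : Submodule (NCPoly g) (Fin ℓ → NCPoly g)} (hI : ∀ q ∈ I, evalAt X v q = 0)
    {p : Fin ℓ → NCPoly g} (hp : p ∈ vanishingRadical I) : evalAt X v p = 0 := by
  -- Orthonormality is what turns adjoints into transposes.
  let b := stdOrthonormalBasis ℝ H
  let M : Fin g → Matrix (Fin (Module.finrank ℝ H)) (Fin (Module.finrank ℝ H)) ℝ :=
    fun i => LinearMap.toMatrixOrthonormal b (X (Sum.inl i))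
  let w : Fin ℓ × Fin (Module.finrank ℝ H) → ℝ := fun ka => b.repr (v ka.1) ka.2
  have hM : ∀ r : NCPoly g, eval M r = LinearMap.toMatrixOrthonormal b (FreeAlgebra.lift ℝ X r) := by
    intro r
    have : eval M = (LinearMap.toMatrixOrthonormal b).toAlgEquiv.toAlgHom.comp
        (FreeAlgebra.lift ℝ X) := by
      ext1
      funext s
      rcases s with i | i
      · simp [eval, M]
      · have h1 := hX (Sum.inl i)
        have h2 : (M i)ᵀ = LinearMap.toMatrixOrthonormal b (X (Sum.inr i)) := by
          rw [← Sum.swap_inl, ← h1, ← LinearMap.star_eq_adjoint, map_star,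
            Matrix.star_eq_conjTranspose, Matrix.conjTranspose_eq_transpose_of_trivial]
        simp [eval, h2]
    rw [this]
    rfl
  have key : ∀ q : Fin ℓ → NCPoly g, (evalRow M q).mulVec w = b.repr (evalAt X v q) := by
    intro q
    rw [evalRow_mulVec, evalAt_apply, map_sum, WithLp.ofLp_sum]
    refine Finset.sum_congr rfl fun k _ => ?_
    rw [hM]
    exact LinearMap.toMatrix_mulVec_repr b.toBasis b.toBasis _ (v k)
  have h0 := hp ⟨_, M, w⟩ (fun q hq => by
    change (evalRow M q).mulVec w = 0
    rw [key, hI q hq, map_zero]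
    rfl)
  change (evalRow M p).mulVec w = 0 at h0
  rw [key] at h0
  exact b.repr.map_eq_zero_iff.1 (WithLp.ofLp_injective 2 h0)

end Transfer

/-! ### Coefficients of a linear pencil -/

section Coefficients

variable {g : ℕ}

/-- The coefficient of the letter `s`. -/
noncomputable def coeff (s : Fin g ⊕ Fin g) : NCPoly g →ₗ[ℝ] ℝ :=
  -- Over the dual numbers, with `s ↦ ε` and the other letters sent to `0`, words of length at least
  -- two vanish and the `ε`-part is the coefficient of `s`.
  TrivSqZeroExt.sndHom ℝ ℝ ∘ₗ
    (FreeAlgebra.lift ℝ fun t => if t = s then TrivSqZeroExt.inr (1 : ℝ) else 0 :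
      NCPoly g →ₐ[ℝ] TrivSqZeroExt ℝ ℝ).toLinearMap

theorem coeff_algebraMap (s : Fin g ⊕ Fin g) (r : ℝ) :
    coeff s (algebraMap ℝ (NCPoly g) r) = 0 := by
  simp [coeff, TrivSqZeroExt.algebraMap_eq_inl]

theorem coeff_ι (s t : Fin g ⊕ Fin g) :
    coeff s (FreeAlgebra.ι ℝ t : NCPoly g) = if t = s then 1 else 0 := by
  by_cases h : t = s <;> simp [coeff, h]

theorem eq_of_mem_degLE_one {p : NCPoly g} (hp : p ∈ degLE g 1) :
    p = algebraMap ℝ (NCPoly g) (FreeAlgebra.algebraMapInv p)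
      + ∑ s, coeff s p • FreeAlgebra.ι ℝ s := by
  induction hp using Submodule.span_induction with
  | mem w hw =>
    obtain ⟨l, hl, rfl⟩ := hw
    rcases l with _ | ⟨t, _ | ⟨r, l⟩⟩
    · have h := fun s : Fin g ⊕ Fin g => coeff_algebraMap s 1
      simp only [map_one] at h
      simp [h]
    · simp [coeff_ι, FreeAlgebra.algebraMapInv]
    · simp at hl
  | zero => simp
  | add p q _ _ hp hq =>
    simp only [map_add, add_smul, Finset.sum_add_distrib]
    nth_rewrite 1 [hp, hq]
    abel
  | smul c p _ hp =>
    nth_rewrite 1 [hp]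
    simp only [Algebra.algebraMap_eq_smul_one, map_smul, smul_add, Finset.smul_sum, smul_smul,
      smul_eq_mul]

theorem coeff_adj {p : NCPoly g} (hp : p ∈ degLE g 1) (s : Fin g ⊕ Fin g) :
    coeff s (adj p) = coeff s.swap p := by
  have hsum : ∀ c : Fin g ⊕ Fin g → ℝ, adj (∑ t, c t • FreeAlgebra.ι ℝ t : NCPoly g)
      = ∑ t, c t • FreeAlgebra.ι ℝ t.swap := by
    intro c
    simp [adj]
  conv_lhs => rw [eq_of_mem_degLE_one hp]
  rw [adj_add, adj_algebraMap, hsum, map_add, coeff_algebraMap, zero_add, map_sum,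
    Finset.sum_eq_single s.swap]
  · simp [coeff_ι]
  · intro t _ ht
    rw [map_smul, coeff_ι, if_neg, smul_zero]
    rintro rfl
    simp at ht
  · simp

theorem IsMonicLinearPencil.exists_coeff {ℓ : ℕ} {L : Matrix (Fin ℓ) (Fin ℓ) (NCPoly g)}
    (hL : IsMonicLinearPencil L) : ∃ B : Fin g ⊕ Fin g → Matrix (Fin ℓ) (Fin ℓ) ℝ,
      (∀ s, (B s)ᵀ = B s.swap) ∧ ∀ i j, L i j =
        algebraMap ℝ (NCPoly g) ((1 : Matrix (Fin ℓ) (Fin ℓ) ℝ) i j)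
          + ∑ s, B s i j • FreeAlgebra.ι ℝ s := by
  refine ⟨fun s => L.map (coeff s), fun s => ?_, fun i j => ?_⟩
  · ext i j
    change coeff s (L j i) = coeff s.swap (L i j)
    rw [← coeff_adj (hL.1.2 i j)]
    conv_lhs => rw [← hL.1.1]
    rfl
  · rw [← hL.2]
    exact eq_of_mem_degLE_one (hL.1.2 i j)

end Coefficients

end NCPoly

namespace NCPoly

open scoped InnerProductSpace

/-! ### Normal forms modulo the left module -/

section NormalForm

variable {g ℓ : ℕ}

/-- The constant row with entries `c`. -/
noncomputable def constRow : EuclideanSpace ℝ (Fin ℓ) →ₗ[ℝ] (Fin ℓ → NCPoly g) where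
  toFun c k := algebraMap ℝ (NCPoly g) (c k)
  map_add' c d := by ext k; simp
  map_smul' r c := by ext k; simp [Algebra.smul_def]

theorem constRow_apply (c : EuclideanSpace ℝ (Fin ℓ)) (k : Fin ℓ) :
    (constRow c : Fin ℓ → NCPoly g) k = algebraMap ℝ (NCPoly g) (c k) := rfl

/-- The product of the letters of a word. -/
noncomputable def word (l : List (Fin g ⊕ Fin g)) : NCPoly g := (l.map (FreeAlgebra.ι ℝ)).prod

theorem word_cons (s : Fin g ⊕ Fin g) (l : List (Fin g ⊕ Fin g)) :
    word (s :: l) = FreeAlgebra.ι ℝ s * word l := by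
  simp [word]

variable {K : Type*} [NormedAddCommGroup K] [InnerProductSpace ℝ K]

/-- The tuples of vectors of `K` indexed by the letters. -/
abbrev LetterSum (g : ℕ) (K : Type*) : Type _ := PiLp 2 (fun _ : Fin g ⊕ Fin g => K)

/-- The embedding of `K` as the summand of the letter `s`. -/
noncomputable def ins (s : Fin g ⊕ Fin g) : K →ₗ[ℝ] LetterSum g K where
  toFun c := PiLp.single 2 s c
  map_add' c d := PiLp.single_add 2 s
  map_smul' r c := by
    ext t
    rcases eq_or_ne t s with rfl | ht
    · simp
    · simp [ht]

theorem ins_apply (s : Fin g ⊕ Fin g) (c : K) : ins s c = PiLp.single 2 s c := rfl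

theorem inner_ins_left (s : Fin g ⊕ Fin g) (c : K) (h : LetterSum g K) :
    ⟪ins s c, h⟫_ℝ = ⟪c, h s⟫_ℝ := by
  rw [PiLp.inner_apply, Finset.sum_eq_single s]
  · simp [ins_apply]
  · intro t _ ht
    simp [ins_apply, ht]
  · simp

theorem sum_ins (h : LetterSum g K) : ∑ s, ins s (h s) = h := by
  ext t
  rw [WithLp.ofLp_sum, Finset.sum_apply, Finset.sum_eq_single t]
  · simp [ins_apply]
  · intro s _ hs
    simp [ins_apply, hs.symm]
  · simp

/-- The homogeneous linear row with coefficients `h`. -/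
noncomputable def linRow (J : K →ₗ[ℝ] EuclideanSpace ℝ (Fin ℓ)) :
    LetterSum g K →ₗ[ℝ] (Fin ℓ → NCPoly g) where
  toFun h := ∑ s, (FreeAlgebra.ι ℝ s : NCPoly g) • constRow (J (h s))
  map_add' h h' := by simp [Finset.sum_add_distrib]
  map_smul' r h := by simp [Finset.smul_sum, smul_comm _ r]

theorem linRow_apply (J : K →ₗ[ℝ] EuclideanSpace ℝ (Fin ℓ)) (h : LetterSum g K) :
    linRow J h = ∑ s, (FreeAlgebra.ι ℝ s : NCPoly g) • constRow (J (h s)) := rfl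

theorem linRow_ins (J : K →ₗ[ℝ] EuclideanSpace ℝ (Fin ℓ)) (s : Fin g ⊕ Fin g) (c : K) :
    linRow J (ins s c) = (FreeAlgebra.ι ℝ s : NCPoly g) • constRow (J c) := by
  rw [linRow_apply, Finset.sum_eq_single s]
  · simp [ins_apply]
  · intro t _ ht
    simp [ins_apply, ht]
  · simp

/-- The row `∑ w · (linRow (u w))`, a sum over words `w`. -/
noncomputable def wordSum (J : K →ₗ[ℝ] EuclideanSpace ℝ (Fin ℓ)) :
    (List (Fin g ⊕ Fin g) →₀ LetterSum g K) →ₗ[ℝ] (Fin ℓ → NCPoly g) :=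
  Finsupp.lsum ℝ fun l =>
    { toFun := fun h => word l • linRow J h
      map_add' := fun h h' => by simp
      map_smul' := fun r h => by simp [smul_comm _ r] }

theorem wordSum_apply (J : K →ₗ[ℝ] EuclideanSpace ℝ (Fin ℓ))
    (u : List (Fin g ⊕ Fin g) →₀ LetterSum g K) :
    wordSum J u = u.sum fun l h => word l • linRow J h := rfl

theorem wordSum_single (J : K →ₗ[ℝ] EuclideanSpace ℝ (Fin ℓ)) (l : List (Fin g ⊕ Fin g))
    (h : LetterSum g K) : wordSum J (Finsupp.single l h) = word l • linRow J h := by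
  rw [wordSum_apply, Finsupp.sum_single_index]
  simp

/-- The coefficient families whose values at nonempty words are fixed by `T`. -/
def fixedFamilies (T : LetterSum g K →ₗ[ℝ] LetterSum g K) :
    Submodule ℝ (List (Fin g ⊕ Fin g) →₀ LetterSum g K) where
  carrier := {u | ∀ l, l ≠ [] → T (u l) = u l}
  add_mem' := fun {u w} hu hw l hl => by
    rw [Finsupp.add_apply, map_add, hu l hl, hw l hl]
  zero_mem' := fun l _ => by simp
  smul_mem' := fun r u hu l hl => by
    rw [Finsupp.smul_apply, map_smul, hu l hl]

theorem single_mem_fixedFamilies {T : LetterSum g K →ₗ[ℝ] LetterSum g K}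
    {l : List (Fin g ⊕ Fin g)} {h : LetterSum g K} (hT : l ≠ [] → T h = h) :
    Finsupp.single l h ∈ fixedFamilies T := by
  classical
  intro m hm
  rw [Finsupp.single_apply]
  split_ifs with hlm
  · exact hT (hlm ▸ hm)
  · simp

/-- Modulo `I`, every row is a sum of words times linear rows, those at nonempty words having
coefficients in the range of `1 - V W`. -/
theorem exists_wordSum_sub_mem {J : K →ₗ[ℝ] EuclideanSpace ℝ (Fin ℓ)}
    {P : EuclideanSpace ℝ (Fin ℓ) →ₗ[ℝ] K} {V : K →ₗ[ℝ] LetterSum g K}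
    {W : LetterSum g K →ₗ[ℝ] K} (hW : ∀ c, W (V c) = c)
    {I : Submodule (NCPoly g) (Fin ℓ → NCPoly g)}
    (hP : ∀ c, constRow c - constRow (J (P c)) ∈ I)
    (hV : ∀ k, constRow (J k) - linRow J (V k) ∈ I) (p : Fin ℓ → NCPoly g) :
    ∃ u ∈ fixedFamilies (LinearMap.id - V ∘ₗ W), p - wordSum J u ∈ I := by
  set T : LetterSum g K →ₗ[ℝ] LetterSum g K := LinearMap.id - V ∘ₗ W with hTdef
  have hTT : ∀ h, T (T h) = T h := fun h => by simp [hTdef, hW]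
  -- `NF` is only a real subspace by construction; it contains the constants, and stability under
  -- the letters then makes it everything.
  let NF : Submodule ℝ (Fin ℓ → NCPoly g) :=
    (fixedFamilies T).map (wordSum J) ⊔ I.restrictScalars ℝ
  have hI : ∀ q ∈ I, q ∈ NF := fun q hq => Submodule.mem_sup_right hq
  have hsingle : ∀ l h, (l ≠ [] → T h = h) → word l • linRow J h ∈ NF := fun l h hT =>
    Submodule.mem_sup_left ⟨_, single_mem_fixedFamilies hT, wordSum_single J l h⟩
  have hconst : ∀ c, constRow c ∈ NF := fun c => by
    have h1 := hsingle [] (V (P c)) (fun h => absurd rfl h)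
    have h2 := hI _ (add_mem (hP c) (hV (P c)))
    have := add_mem h1 h2
    simpa [word] using this
  have hletter : ∀ s, ∀ q ∈ NF, (FreeAlgebra.ι ℝ s : NCPoly g) • q ∈ NF := by
    intro s q hq
    obtain ⟨_, ⟨u, hu, rfl⟩, m, hm, rfl⟩ := Submodule.mem_sup.1 hq
    rw [smul_add]
    refine add_mem ?_ (hI _ (I.smul_mem _ hm))
    rw [wordSum_apply, Finsupp.sum, Finset.smul_sum]
    refine Submodule.sum_mem _ fun l _ => ?_
    rcases eq_or_ne l [] with rfl | hl
    · have h1 : u [] = V (W (u [])) + T (u []) := by simp [hTdef]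
      generalize u [] = h at h1
      have h2 := hsingle [s] (T h) (fun _ => hTT h)
      have h3 := hsingle [] (ins s (W h)) (fun h => absurd rfl h)
      have h4 := hI _ (I.smul_mem (FreeAlgebra.ι ℝ s) (hV (W h)))
      rw [h1, map_add]
      have h5 := sub_mem (add_mem h2 h3) h4
      simp only [word, List.map_nil, List.prod_nil, one_smul, linRow_ins, List.map_cons, mul_one,
        List.prod_cons, smul_sub, smul_add] at h5 ⊢
      convert h5 using 1
      abel
    · rw [smul_smul, ← word_cons]
      exact hsingle _ _ fun _ => hu l hl
  have hmul : ∀ (r : NCPoly g), ∀ q ∈ NF, r • q ∈ NF := by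
    intro r
    induction r using FreeAlgebra.induction with
    | grade0 c =>
      intro q hq
      rw [algebraMap_smul]
      exact NF.smul_mem c hq
    | grade1 s => exact hletter s
    | mul a b ha hb =>
      intro q hq
      rw [mul_smul]
      exact ha _ (hb _ hq)
    | add a b ha hb =>
      intro q hq
      rw [add_smul]
      exact add_mem (ha _ hq) (hb _ hq)
  have hp : p ∈ NF := by
    have : p = ∑ k, p k • constRow (EuclideanSpace.single k (1 : ℝ)) := by
      ext j
      simp [constRow_apply, Finset.sum_apply, apply_ite]
    rw [this]
    exact Submodule.sum_mem _ fun k _ => hmul _ _ (hconst _)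
  obtain ⟨_, ⟨u, hu, rfl⟩, m, hm, h⟩ := Submodule.mem_sup.1 hp
  refine ⟨u, hu, ?_⟩
  rw [← h, add_sub_cancel_left]
  exact hm

end NormalForm

/-! ### A point that detects membership -/

section Faithful

set_option linter.unusedSectionVars false

variable {g ℓ : ℕ} {K : Type*} [NormedAddCommGroup K] [InnerProductSpace ℝ K]
  [FiniteDimensional ℝ K]

theorem evalAt_constRow {H : Type*} [NormedAddCommGroup H] [InnerProductSpace ℝ H]
    (X : Fin g ⊕ Fin g → H →ₗ[ℝ] H) (A : EuclideanSpace ℝ (Fin ℓ) →ₗ[ℝ] H)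
    (c : EuclideanSpace ℝ (Fin ℓ)) :
    evalAt X (fun k => A (EuclideanSpace.single k 1)) (constRow c) = A c := by
  have hc : c = ∑ k, c k • EuclideanSpace.single k (1 : ℝ) := by
    ext j
    simp [Pi.single_apply]
  conv_rhs => rw [hc]
  simp only [evalAt_apply, constRow_apply, AlgHom.commutes, map_sum, map_smul,
    Module.algebraMap_end_apply]

/-- The vectors `-b_{s*} c`, as a tuple indexed by the letters. -/
noncomputable def pencilVec (b : Fin g ⊕ Fin g → K →ₗ[ℝ] K) : K →ₗ[ℝ] LetterSum g K where
  toFun c := WithLp.toLp 2 fun s => -b s.swap c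
  map_add' c d := by ext s; simp [add_comm]
  map_smul' r c := by ext s; simp

theorem pencilVec_apply (b : Fin g ⊕ Fin g → K →ₗ[ℝ] K) (c : K) (s : Fin g ⊕ Fin g) :
    pencilVec b c s = -b s.swap c := rfl

/-- Both sides are `-b s`; the relation `b_s* = b_{s*}`, inherited from `L = L*`, enters here. -/
theorem ins_adjoint_comp_pencilVec {b : Fin g ⊕ Fin g → K →ₗ[ℝ] K}
    (hb : ∀ s, (b s).adjoint = b s.swap) (s : Fin g ⊕ Fin g) :
    (ins s.swap : K →ₗ[ℝ] LetterSum g K).adjoint ∘ₗ pencilVec b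
      = (pencilVec b).adjoint ∘ₗ ins s := by
  ext c
  refine ext_inner_right ℝ fun d => ?_
  rw [LinearMap.comp_apply, LinearMap.comp_apply, LinearMap.adjoint_inner_left,
    LinearMap.adjoint_inner_left, inner_ins_left, real_inner_comm, inner_ins_left,
    pencilVec_apply, pencilVec_apply, inner_neg_right, inner_neg_right, Sum.swap_swap, ← hb s,
    LinearMap.adjoint_inner_right, real_inner_comm]

/-- The core argument, with `K` standing for the complement of the joint kernel, `J` for its
inclusion and `P` for the projection. The injectivity `hker` is what provides `W`. -/
theorem mem_of_mem_vanishingRadical {b : Fin g ⊕ Fin g → K →ₗ[ℝ] K}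
    (hb : ∀ s, (b s).adjoint = b s.swap) (hker : ∀ c, (∀ s, b s c = 0) → c = 0)
    {β : Fin g ⊕ Fin g → EuclideanSpace ℝ (Fin ℓ) →ₗ[ℝ] EuclideanSpace ℝ (Fin ℓ)}
    {J : K →ₗ[ℝ] EuclideanSpace ℝ (Fin ℓ)} {P : EuclideanSpace ℝ (Fin ℓ) →ₗ[ℝ] K}
    (hPJ : ∀ c, P (J c) = c) (hβP : ∀ s c, b s (P c) = P (β s c))
    (hβJ : ∀ s c, J (b s c) = β s (J c)) (hβ : ∀ s c, β s (J (P c)) = β s c)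
    {I : Submodule (NCPoly g) (Fin ℓ → NCPoly g)}
    (hI : I = Submodule.span (NCPoly g) (Set.range fun c =>
      constRow c + ∑ s, (FreeAlgebra.ι ℝ s : NCPoly g) • constRow (β s.swap c)))
    {p : Fin ℓ → NCPoly g} (hp : p ∈ vanishingRadical I) : p ∈ I := by
  have hgen : ∀ c, constRow c + ∑ s, (FreeAlgebra.ι ℝ s : NCPoly g) • constRow (β s.swap c) ∈ I :=
    fun c => hI ▸ Submodule.subset_span ⟨c, rfl⟩
  set V : K →ₗ[ℝ] LetterSum g K := pencilVec b with hVdef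
  have hVinj : LinearMap.ker V = ⊥ := by
    rw [LinearMap.ker_eq_bot']
    refine fun c hc => hker c fun s => ?_
    have := congrArg (fun h : LetterSum g K => h s.swap) hc
    simpa [hVdef, pencilVec_apply] using this
  obtain ⟨W, hW'⟩ := V.exists_leftInverse_of_injective hVinj
  have hW : ∀ c, W (V c) = c := fun c => LinearMap.congr_fun hW' c
  obtain ⟨u, hu, hpu⟩ := exists_wordSum_sub_mem (J := J) (P := P) hW (I := I)
    (fun c => by
      -- By `hβ` every `β s` kills this vector, so its generator is a constant row.
      have := hgen (c - J (P c))
      simpa [hβ] using this)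
    (fun k => by
      have := hgen (J k)
      simpa [-Fintype.sum_sum_type, linRow_apply, hVdef, pencilVec_apply, hβJ] using this) p
  set T : LetterSum g K →ₗ[ℝ] LetterSum g K := LinearMap.id - V ∘ₗ W with hTdef
  have hTT : ∀ h, T (T h) = T h := fun h => by simp [hTdef, hW]
  have hTV : ∀ c, T (V c) = 0 := fun c => by simp [hTdef, hW]
  let a : Fin g ⊕ Fin g → LetterSum g K →ₗ[ℝ] LetterSum g K := fun s =>
    extendAlong V W (ins s) (ins s.swap)
  have ha : ∀ s, (a s).adjoint = a s.swap := fun s => by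
    simpa [a] using extendAlong_adjoint (W := W) (ins_adjoint_comp_pencilVec hb s)
  have haV : ∀ s c, a s (V c) = ins s c := fun s c =>
    extendAlong_apply hW (ins_adjoint_comp_pencilVec hb s) c
  -- The truncation depends on `p`: words of length up to `N` must survive, hence the strict bound
  -- `N + 1`.
  let N := u.support.sup List.length
  let X : Fin g ⊕ Fin g → Fock (Fin g ⊕ Fin g) (LetterSum g K) (N + 1) →ₗ[ℝ]
      Fock (Fin g ⊕ Fin g) (LetterSum g K) (N + 1) := fockOp Sum.swap T a
  have hX : ∀ s, (X s).adjoint = X s.swap := fockOp_adjoint Sum.swap_swap ha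
  -- A constant row `c` is congruent to the linear row with coefficients `V (P c)`, so this vacuum
  -- vector is its value.
  let A : EuclideanSpace ℝ (Fin ℓ) →ₗ[ℝ] Fock (Fin g ⊕ Fin g) (LetterSum g K) (N + 1) :=
    vacuum N ∘ₗ V ∘ₗ P
  let v : Fin ℓ → Fock (Fin g ⊕ Fin g) (LetterSum g K) (N + 1) :=
    fun k => A (EuclideanSpace.single k 1)
  have hlin : ∀ s c, evalAt X v ((FreeAlgebra.ι ℝ s : NCPoly g) • constRow c)
      = vacuum N (ins s (P c)) := fun s c => by
    rw [evalAt_smul, evalAt_constRow, FreeAlgebra.lift_ι_apply]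
    change fockOp _ _ _ _ (vacuum N (V (P c))) = _
    rw [fockOp_vacuum (hTV _), haV]
  have hzero : ∀ q ∈ I, evalAt X v q = 0 := by
    intro q hq
    rw [hI] at hq
    refine evalAt_eq_zero_of_mem_span ?_ hq
    rintro _ ⟨c, rfl⟩
    simp only [map_add, map_sum, hlin, v, evalAt_constRow]
    change vacuum N (V (P c)) + _ = _
    rw [← map_sum, ← map_add]
    have : V (P c) + ∑ s, ins s (P (β s.swap c)) = 0 := by
      rw [← sum_ins (V (P c)), ← Finset.sum_add_distrib]
      refine Finset.sum_eq_zero fun s _ => ?_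
      rw [hVdef, pencilVec_apply, ← hβP, map_neg, neg_add_cancel]
    rw [this, map_zero]
  have hword : ∀ l h, evalAt X v (word l • linRow J h) = (l.map X).prod (vacuum N h) := by
    intro l h
    have h1 : evalAt X v (linRow J h) = vacuum N h := by
      simp only [linRow_apply, map_sum, hlin, hPJ]
      rw [← map_sum, sum_ins]
    rw [evalAt_smul, h1, word, map_list_prod, List.map_map]
    congr 3
    funext s
    simp
  have h0 : evalAt X v (wordSum J u) = 0 := by
    have h1 := hzero _ hpu
    rw [map_sub, evalAt_eq_zero_of_mem_vanishingRadical hX hzero hp, zero_sub, neg_eq_zero] at h1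
    exact h1
  rw [wordSum_apply, Finsupp.sum, map_sum] at h0
  simp only [hword] at h0
  have hu0 : u = 0 := eq_zero_of_sum_fockOp_eq_zero hTT u hu
    (fun l hl => Finset.le_sup (f := List.length) hl) h0
  simpa [hu0] using hpu

end Faithful

/-! ### Application to a monic linear pencil -/

section Pencil

variable {g ℓ : ℕ}

theorem vanishingRadical_rowModule_le {L : Matrix (Fin ℓ) (Fin ℓ) (NCPoly g)}
    (hL : IsMonicLinearPencil L) : vanishingRadical (rowModule L) ≤ rowModule L := by
  obtain ⟨B, hBt, hB⟩ := hL.exists_coeff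
  let β : Fin g ⊕ Fin g → EuclideanSpace ℝ (Fin ℓ) →ₗ[ℝ] EuclideanSpace ℝ (Fin ℓ) :=
    fun s => Matrix.toEuclideanLin (B s)
  have hβadj : ∀ s, (β s).adjoint = β s.swap := fun s => by
    rw [← Matrix.toEuclideanLin_conjTranspose_eq_adjoint,
      Matrix.conjTranspose_eq_transpose_of_trivial, hBt]
  -- Splitting off the joint kernel is what makes `V` injective.
  let Z : Submodule ℝ (EuclideanSpace ℝ (Fin ℓ)) := ⨅ s, LinearMap.ker (β s)
  have hZ : ∀ c, c ∈ Z ↔ ∀ s, β s c = 0 := fun c => by simp [Z]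
  have hrange : ∀ s c, β s c ∈ Zᗮ := fun s c => by
    rw [Submodule.mem_orthogonal]
    intro y hy
    rw [← LinearMap.adjoint_inner_left, hβadj, (hZ y).1 hy, inner_zero_left]
  let P : EuclideanSpace ℝ (Fin ℓ) →ₗ[ℝ] Zᗮ := Zᗮ.orthogonalProjectionOnto.toLinearMap
  have hβP : ∀ s c, β s (P c : EuclideanSpace ℝ (Fin ℓ)) = β s c := fun s c => by
    have h1 : c - (P c : EuclideanSpace ℝ (Fin ℓ)) ∈ Z := by
      have := Submodule.sub_starProjection_mem_orthogonal (K := Zᗮ) c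
      rwa [Submodule.orthogonal_orthogonal] at this
    have := (hZ _).1 h1 s
    rw [map_sub, sub_eq_zero] at this
    exact this.symm
  have hPmem : ∀ c : Zᗮ, P c = c := fun c =>
    Submodule.orthogonalProjectionOnto_mem_subspace_eq_self c
  let b : Fin g ⊕ Fin g → Zᗮ →ₗ[ℝ] Zᗮ := fun s =>
    (β s ∘ₗ Zᗮ.subtype).codRestrict Zᗮ fun c => hrange s c
  have hb : ∀ s c, (b s c : EuclideanSpace ℝ (Fin ℓ)) = β s c := fun s c => rfl
  intro p hp
  refine mem_of_mem_vanishingRadical (b := b) (β := β) (J := Zᗮ.subtype) (P := P)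
    (fun s => ?_) (fun c hc => ?_) hPmem (fun s c => ?_) (fun s c => rfl) hβP ?_ hp
  · symm
    rw [LinearMap.eq_adjoint_iff]
    intro c d
    rw [Submodule.coe_inner, Submodule.coe_inner, hb, hb, ← hβadj, LinearMap.adjoint_inner_left]
  · have h1 : (c : EuclideanSpace ℝ (Fin ℓ)) ∈ Z :=
      (hZ _).2 fun s => congrArg Subtype.val (hc s)
    exact Subtype.ext (inner_self_eq_zero.1 (c.2 _ h1))
  · rw [← hPmem (b s (P c)), hb, hβP]
  -- The row `cᵀL` has `x_s`-coefficient `B_sᵀ c = B_{s*} c`, which explains the `s.swap`.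
  · have hrow : ∀ c : EuclideanSpace ℝ (Fin ℓ),
        constRow c + ∑ s, (FreeAlgebra.ι ℝ s : NCPoly g) • constRow (β s.swap c)
          = ∑ j, algebraMap ℝ (NCPoly g) (c j) • L.row j := by
      intro c
      ext k
      simp only [Pi.add_apply, Finset.sum_apply, Pi.smul_apply, constRow_apply, smul_eq_mul,
        Matrix.row, hB, mul_add, Finset.sum_add_distrib]
      congr 1
      · rw [Finset.sum_eq_single k]
        · simp
        · intro j _ hj
          simp [hj]
        · simp
      · simp only [Finset.mul_sum]
        rw [Finset.sum_comm]
        refine Finset.sum_congr rfl fun s _ => ?_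
        have : (β s.swap c) k = ∑ j, c j * B s j k := by
          simp only [β, ← hBt]
          simp [Matrix.toLpLin_apply, Matrix.mulVec, dotProduct, mul_comm]
        rw [this, map_sum, Finset.mul_sum]
        refine Finset.sum_congr rfl fun j _ => ?_
        rw [← Algebra.commutes, map_mul, mul_assoc, Algebra.smul_def]
    refine le_antisymm (Submodule.span_le.2 ?_) (Submodule.span_le.2 ?_)
    · rintro _ ⟨j, rfl⟩
      refine Submodule.subset_span ⟨EuclideanSpace.single j 1, ?_⟩
      simp only [hrow]
      rw [Finset.sum_eq_single j]
      · simp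
      · intro i _ hi
        simp [hi]
      · simp
    · rintro _ ⟨c, rfl⟩
      simp only [hrow]
      exact Submodule.sum_mem _ fun j _ =>
        Submodule.smul_mem _ _ (Submodule.subset_span ⟨j, rfl⟩)

end Pencil

end NCPoly

theorem proposition1p7 (g ℓ : ℕ) (L : Matrix (Fin ℓ) (Fin ℓ) (NCPoly g))
    (hL : NCPoly.IsMonicLinearPencil L) :
    NCPoly.rowModule L = NCPoly.realRadical (NCPoly.rowModule L) ∧
      NCPoly.realRadical (NCPoly.rowModule L) = NCPoly.vanishingRadical (NCPoly.rowModule L) := by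
  have h1 := NCPoly.le_realRadical (NCPoly.rowModule L)
  have h2 := NCPoly.realRadical_le_vanishingRadical (NCPoly.rowModule L)
  have h3 := NCPoly.vanishingRadical_rowModule_le hL
  exact ⟨le_antisymm h1 (h2.trans h3), le_antisymm h2 (h3.trans h1)⟩
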